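/- Let $B>0$ and let $d,n\ge 1$ be integers, let $q\in\mathbb{R}$, and let $\mathcal X$ be a non-empty measurable space whose $\sigma$-algebra separates points. A prediction function is a measurable map $g:\mathcal X\to[-B,B]$. For a probability distribution $P$ on $\mathcal X\times[-B,B]$ the risk of $g$ is $R(g)=\mathbb E_{(X,Y)\sim P}|Y-g(X)|^q$. An estimator $\hat g$ is a (possibly randomized) map from training sets $Z_1^n\in(\mathcal X\times[-B,B])^n$ to prediction functions, such that $\hat g(x)$ depends in a jointly measurable way on the training set, the auxiliary random seed and the input $x$; $\mathbb ER(\hat g)$ denotes its expected risk when $Z_1,\dots,Z_n$ are i.i.d. with distribution $P$. Write $m=\lfloor\log_2 d\rfloor$, $a\wedge b=\min(a,b)$ and $a\vee b=\max(a,b)$. (a) Suppose that $1\le q\le 1+\left(\sqrt{\tfrac{m}{4n}}\wedge 1\right)$ and that $\mathcal X$ contains at least $\lfloor\log_2 d\rfloor$ points. Put $c_q=\tfrac14$ if $q=1$ and $c_q=\tfrac{q}{40}$ if $q>1$. Then there exists a set $\mathcal G$ of $d$ prediction functions such that for any estimator $\hat g$ there exists a probability distribution $P$ on $\mathcal X\times[-B,B]$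 for which $$\mathbb ER(\hat g)-\min_{g\in\mathcal G}R(g)\ \ge\ \begin{cases} c_q\,B^q\sqrt{\dfrac{\lfloor\log_2 |\mathcal G|\rfloor}{n}}, & \text{if } |\mathcal G|<2^{4n+1},\\[2mm] 2c_q\,B^q, & \text{otherwise.}\end{cases}$$ (b) Suppose that $q> 1+\left(\sqrt{\tfrac{m}{4n}}\wedge 1\right)$ and that $\mathcal X$ contains at least $\lfloor\log_2(2d)\rfloor$ points. Then there exists a set $\mathcal G$ of $d$ prediction functions such that for any estimator $\hat g$ there exists a probability distribution $P$ on $\mathcal X\times[-B,B]$ for which $$\mathbb ER(\hat g)-\min_{g\in\mathcal G}R(g)\ \ge\ \left(\frac{q}{90(q-1)}\vee e^{-1}\right)B^q\left(\frac{\lfloor\log_2|\mathcal G|\rfloor}{n+1}\wedge 1\right).$$ -/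

import Mathlib

universe u w

noncomputable section

namespace LqRegression

open MeasureTheory ProbabilityTheory

/-- A data point: an input in `X` together with an output in `[-B, B]`. -/
abbrev Data (X : Type u) (B : ℝ) : Type u := X × Set.Icc (-B) B

/-- A training set of size `n`. -/
abbrev TrainingSet (X : Type u) (B : ℝ) (n : ℕ) : Type u := Fin n → Data X B

/-- Prediction functions: the measurable functions from `X` to `[-B, B]`. -/
abbrev PredictionFunction (X : Type u) [MeasurableSpace X] (B : ℝ) : Type u :=
  {g : X → Set.Icc (-B) B // Measurable g}

/-- The risk `R(g) = E |Y - g(X)| ^ q` of a function `g`, where `(X, Y)` has distribution `P`. -/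
def risk {X : Type u} [MeasurableSpace X] {B : ℝ} (q : ℝ) (P : Measure (Data X B))
    (g : X → Set.Icc (-B) B) : ℝ :=
  ∫ z, |(z.2 : ℝ) - (g z.1 : ℝ)| ^ q ∂P

/-- A (possibly randomized) estimator for training sets of size `n`: given the training set `S`,
a random seed `θ` is drawn from `law S`, and the prediction function `predict S θ` is output.
Predictions depend in a jointly measurable way on the training set, the seed and the input.
Deterministic estimators are those whose type of seeds has only one element. -/
structure Estimator (X : Type u) [MeasurableSpace X] (B : ℝ) (n : ℕ) where
  Seed : Type w
  [measurableSpaceSeed : MeasurableSpace Seed]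
  law : Kernel (TrainingSet X B n) Seed
  [isMarkovKernel_law : IsMarkovKernel law]
  predict : TrainingSet X B n → Seed → X → Set.Icc (-B) B
  measurable_predict :
    Measurable fun p : (TrainingSet X B n × Seed) × X => predict p.1.1 p.1.2 p.2

attribute [instance] Estimator.measurableSpaceSeed Estimator.isMarkovKernel_law

/-- The expected risk of an estimator trained on `n` independent data points with distribution
`P`; the expectation is over the training set and over the seed. -/
def Estimator.expectedRisk {X : Type u} [MeasurableSpace X] {B : ℝ} {n : ℕ}
    (f : Estimator.{u, w} X B n) (q : ℝ) (P : Measure (Data X B)) : ℝ :=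
  ∫ S, ∫ θ, risk q P (f.predict S θ) ∂(f.law S) ∂(Measure.pi fun _ : Fin n => P)

/-- The excess risk with respect to the best element of the finite set `G`. -/
def Estimator.excessRisk {X : Type u} [MeasurableSpace X] {B : ℝ} {n : ℕ}
    (f : Estimator.{u, w} X B n) (q : ℝ) (P : Measure (Data X B))
    (G : Finset (PredictionFunction X B)) : ℝ :=
  f.expectedRisk q P - ⨅ g : G, risk q P g.1.1

/-- The threshold `1 + (√(⌊log₂ d⌋ / (4 n)) ∧ 1)` separating the small and the large values
of `q`. -/
def criticalExponent (d n : ℕ) : ℝ :=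
  1 + min (Real.sqrt ((Nat.log 2 d : ℝ) / (4 * (n : ℝ)))) 1

/-- The constant `c_q` of the lower bound for `q` equal or close to `1`. -/
def smallExponentConst (q : ℝ) : ℝ :=
  if q = 1 then 1 / 4 else q / 40

end LqRegression

end

/-! This is a hypercube (Assouad) argument. Put `m = Nat.log 2 d`. Each of `m` points carries mass
`w`, and its label is `±B` with bias `ξ` towards a hidden sign `σ i`; any remaining mass sits at one
extra point with a known label. Predicting `σ i * h * B`, with `h` the best shrinkage for bias `ξ`,
costs `m * w * φ * B ^ q`, where `φ = noisyLoss q ξ h`. These `2 ^ m ≤ d` functions depend only on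
`q` and `ξ`, so `G` is fixed before the estimator is seen.

An estimator must tell `σ` from `flipAt i σ`. If the laws of the two samples share mass at least
`M`, then on the shared part it cannot beat the trivial prediction, of normalized loss 1, and
elsewhere it cannot beat `φ`. Averaging over `σ` yields excess risk at least `m * w * (1 - φ) * M *
B ^ q` for some `σ` (`exists_cube_lower_bound`, `exists_law_excessRisk_lower_bound`). Since `φ` is a
minimum, `1 - φ ≥ 1 - (1 - ξ) * 2 ^ (q - 1)`.

Two values of `M` are available: `(1 - w) ^ n`, because the sample may miss the point
(`pow_le_sum_min`), and `1 / 2` once `n * w * ξ ^ 2 ≤ 1 / 4`, through a harmonic-mean affinity that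
is supermultiplicative over observations (`half_le_sum_min`). All cases of the theorem are choices
of `w`, `ξ` and one of these two values. -/

noncomputable section

namespace LqRegression

open MeasureTheory ProbabilityTheory

/-! ### Finitely supported laws and their powers -/

section DiscreteLaw

variable {I : Type*} [Fintype I] {Z : Type*} [MeasurableSpace Z]

/-- The finitely supported measure with mass `p a` at the point `e a`. -/
def discreteLaw (p : I → ℝ) (e : I → Z) : Measure Z :=
  ∑ a, ENNReal.ofReal (p a) • Measure.dirac (e a)

theorem isProbabilityMeasure_discreteLaw {p : I → ℝ} (hp : ∀ a, 0 ≤ p a) (h1 : ∑ a, p a = 1)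
    (e : I → Z) : IsProbabilityMeasure (discreteLaw p e) := by
  constructor
  simp only [discreteLaw, Measure.coe_finsetSum, Finset.sum_apply, Measure.smul_apply,
    measure_univ, smul_eq_mul, mul_one]
  rw [← ENNReal.ofReal_sum_of_nonneg fun a _ => hp a, h1, ENNReal.ofReal_one]

theorem integral_discreteLaw {p : I → ℝ} (hp : ∀ a, 0 ≤ p a) (e : I → Z) {F : Z → ℝ}
    (hF : StronglyMeasurable F) : ∫ z, F z ∂discreteLaw p e = ∑ a, p a * F (e a) := by
  rw [discreteLaw, integral_finsetSum_measure]
  · refine Finset.sum_congr rfl fun a _ => ?_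
    -- Singletons need not be measurable in `Z`, hence the version for strongly measurable
    -- integrands.
    rw [integral_smul_measure, integral_dirac' _ _ hF, ENNReal.toReal_ofReal (hp a), smul_eq_mul]
  · intro a _
    exact (integrable_dirac' hF (by simp)).smul_measure ENNReal.ofReal_ne_top

theorem pi_discreteLaw {p : I → ℝ} (hp : ∀ a, 0 ≤ p a) (h1 : ∑ a, p a = 1) (e : I → Z) (n : ℕ) :
    Measure.pi (fun _ : Fin n => discreteLaw p e) =
      discreteLaw (fun s : Fin n → I => ∏ k, p (s k)) (fun s k => e (s k)) := by
  classical
  have := isProbabilityMeasure_discreteLaw hp h1 e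
  refine Measure.pi_eq fun S hS => ?_
  simp only [discreteLaw, Measure.coe_finsetSum, Finset.sum_apply, Measure.smul_apply,
    smul_eq_mul]
  rw [Fintype.prod_sum]
  refine Finset.sum_congr rfl fun s _ => ?_
  rw [Measure.dirac_apply' _ (MeasurableSet.univ_pi hS), Finset.prod_mul_distrib,
    ENNReal.ofReal_prod_of_nonneg fun k _ => hp _]
  congr 1
  simp_rw [Measure.dirac_apply' _ (hS _)]
  simp only [Set.indicator_apply, Pi.one_apply, Set.mem_univ_pi]
  split_ifs with h
  · simp [h]
  · push Not at h
    obtain ⟨k, hk⟩ := h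
    exact (Finset.prod_eq_zero (Finset.mem_univ k) (by simp [hk])).symm

end DiscreteLaw

/-! ### Risk under finitely supported laws -/

section Risk

variable {I : Type*} [Fintype I] {X : Type u} [MeasurableSpace X] {B : ℝ} {n : ℕ}

theorem risk_discreteLaw {p : I → ℝ} (hp : ∀ a, 0 ≤ p a) (e : I → Data X B) (q : ℝ)
    {g : X → Set.Icc (-B) B} (hg : Measurable g) :
    risk q (discreteLaw p e) g = ∑ a, p a * |((e a).2 : ℝ) - (g (e a).1 : ℝ)| ^ q := by
  refine integral_discreteLaw hp e (F := fun z => |(z.2 : ℝ) - (g z.1 : ℝ)| ^ q) ?_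
  refine Measurable.stronglyMeasurable ?_
  have h1 : Measurable fun z : Data X B => (z.2 : ℝ) := measurable_subtype_coe.comp measurable_snd
  have h2 : Measurable fun z : Data X B => (g z.1 : ℝ) :=
    measurable_subtype_coe.comp (hg.comp measurable_fst)
  exact (_root_.continuous_abs.measurable.comp (h1.sub h2)).pow_const q

/-- The expected loss at the data point `z` of the estimator `f` trained on `S`. -/
def Estimator.pointLoss (f : Estimator.{u, w} X B n) (q : ℝ) (S : TrainingSet X B n)
    (z : Data X B) : ℝ :=
  ∫ θ, |(z.2 : ℝ) - (f.predict S θ z.1 : ℝ)| ^ q ∂f.law S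

theorem Estimator.measurable_loss (f : Estimator.{u, w} X B n) (q : ℝ) (z : Data X B) :
    Measurable fun p : TrainingSet X B n × f.Seed =>
      |(z.2 : ℝ) - (f.predict p.1 p.2 z.1 : ℝ)| ^ q := by
  have h : Measurable fun p : TrainingSet X B n × f.Seed => (f.predict p.1 p.2 z.1 : ℝ) :=
    measurable_subtype_coe.comp
      (f.measurable_predict.comp (measurable_id.prodMk measurable_const))
  exact (_root_.continuous_abs.measurable.comp (measurable_const.sub h)).pow_const q

theorem Estimator.integrable_loss (f : Estimator.{u, w} X B n) {q : ℝ} (hq : 0 ≤ q)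
    (S : TrainingSet X B n) (z : Data X B) :
    Integrable (fun θ => |(z.2 : ℝ) - (f.predict S θ z.1 : ℝ)| ^ q) (f.law S) := by
  refine Integrable.of_bound
    ((f.measurable_loss q z).comp measurable_prodMk_left).aestronglyMeasurable
    ((2 * B) ^ q) (Filter.Eventually.of_forall fun θ => ?_)
  rw [Real.norm_eq_abs, abs_of_nonneg (by positivity)]
  refine Real.rpow_le_rpow (abs_nonneg _) ?_ hq
  have h1 := z.2.2
  have h2 := (f.predict S θ z.1).2
  rw [abs_le]
  constructor <;> linarith [h1.1, h1.2, h2.1, h2.2]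

theorem Estimator.expectedRisk_discreteLaw (f : Estimator.{u, w} X B n) {p : I → ℝ}
    (hp : ∀ a, 0 ≤ p a) (h1 : ∑ a, p a = 1) (e : I → Data X B) {q : ℝ} (hq : 0 ≤ q) :
    f.expectedRisk q (discreteLaw p e) =
      ∑ s : Fin n → I, (∏ k, p (s k)) *
        ∑ a, p a * f.pointLoss q (fun k => e (s k)) (e a) := by
  have hm : ∀ S θ, Measurable (f.predict S θ) := fun S θ =>
    f.measurable_predict.comp (measurable_prodMk_left (x := (S, θ)))
  have hr : ∀ S, ∫ θ, risk q (discreteLaw p e) (f.predict S θ) ∂f.law S =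
      ∑ a, p a * f.pointLoss q S (e a) := by
    intro S
    simp_rw [risk_discreteLaw hp e q (hm S _)]
    rw [integral_finsetSum _ fun a _ => (f.integrable_loss hq S (e a)).const_mul _]
    simp_rw [integral_const_mul]
    rfl
  rw [Estimator.expectedRisk, pi_discreteLaw hp h1]
  simp_rw [hr]
  refine integral_discreteLaw (fun s => Finset.prod_nonneg fun k _ => hp _) _
    (F := fun S => ∑ a, p a * f.pointLoss q S (e a)) ?_
  refine Finset.stronglyMeasurable_fun_sum _ fun a _ => ?_
  exact (StronglyMeasurable.integral_kernel_prod_right' (κ := f.law)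
    (f.measurable_loss q (e a)).stronglyMeasurable).const_mul (p a)

/-- Transfers scalar inequalities in the normalized prediction `t = g / B` to the estimator by
integrating over the seed; randomization therefore gives no advantage. -/
theorem Estimator.const_le_weighted_pointLoss (f : Estimator.{u, w} X B n) {q : ℝ} (hq : 0 ≤ q)
    (hB : 0 < B) (S : TrainingSet X B n) {a b c : ℝ}
    (h : ∀ t ∈ Set.Icc (-1 : ℝ) 1, c ≤ a * (1 - t) ^ q + b * (1 + t) ^ q) (x : X)
    {y y' : Set.Icc (-B) B} (hy : (y : ℝ) = B) (hy' : (y' : ℝ) = -B) :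
    c * B ^ q ≤ a * f.pointLoss q S (x, y) + b * f.pointLoss q S (x, y') := by
  rw [Estimator.pointLoss, Estimator.pointLoss, ← integral_const_mul, ← integral_const_mul,
    ← integral_add ((f.integrable_loss hq S _).const_mul _)
      ((f.integrable_loss hq S _).const_mul _)]
  have hc : c * B ^ q = ∫ _, c * B ^ q ∂f.law S := by simp
  rw [hc]
  refine integral_mono (integrable_const _) (((f.integrable_loss hq S _).const_mul _).add
      ((f.integrable_loss hq S _).const_mul _)) fun θ => ?_
  obtain ⟨g, hg⟩ := f.predict S θ x
  dsimp only
  have ht : g / B ∈ Set.Icc (-1 : ℝ) 1 :=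
    ⟨by rw [le_div_iff₀ hB]; linarith [hg.1], by rw [div_le_iff₀ hB]; linarith [hg.2]⟩
  have e1 : |(y : ℝ) - g| ^ q = (1 - g / B) ^ q * B ^ q := by
    rw [hy, abs_of_nonneg (by linarith [hg.2]),
      ← Real.mul_rpow (by linarith [ht.2]) hB.le]
    congr 1
    field_simp
  have e2 : |(y' : ℝ) - g| ^ q = (1 + g / B) ^ q * B ^ q := by
    rw [hy', abs_of_nonpos (by linarith [hg.1]),
      ← Real.mul_rpow (by linarith [ht.1]) hB.le]
    congr 1
    field_simp
    ring
  have := mul_le_mul_of_nonneg_right (h _ ht) (Real.rpow_nonneg hB.le q)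
  rw [e1, e2]
  linarith

end Risk

/-! ### The harmonic mean as an affinity between likelihoods -/

section HarmonicMean

/-- The harmonic mean of two nonnegative numbers. -/
def harmonicMean (P Q : ℝ) : ℝ := 2 * P * Q / (P + Q)

theorem harmonicMean_mul_right (P Q : ℝ) {c : ℝ} :
    harmonicMean (P * c) (Q * c) = c * harmonicMean P Q := by
  rcases eq_or_ne c 0 with rfl | hc
  · simp [harmonicMean]
  · rw [harmonicMean, harmonicMean, ← add_mul,
      show 2 * (P * c) * (Q * c) = c * (2 * P * Q) * c by ring, mul_div_mul_right _ _ hc,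
      mul_div_assoc]

/-- After clearing the denominator, for `P ≤ Q`, the difference is `(3 * P - Q) ^ 2 / 8`. -/
theorem harmonicMean_sub_le_min {P Q : ℝ} (hP : 0 ≤ P) (hQ : 0 ≤ Q) :
    harmonicMean P Q - (P + Q) / 8 ≤ min P Q := by
  rcases (add_nonneg hP hQ).eq_or_lt with h | h
  · have h1 : P = 0 := by linarith
    have h2 : Q = 0 := by linarith
    simp [harmonicMean, h1, h2]
  · rw [sub_le_iff_le_add, harmonicMean, div_le_iff₀ h]
    rcases le_total P Q with hPQ | hPQ
    · rw [min_eq_left hPQ]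
      nlinarith [sq_nonneg (3 * P - Q)]
    · rw [min_eq_right hPQ]
      nlinarith [sq_nonneg (3 * Q - P)]

/-- Up to a common factor, the two denominators on the right have sum `2 * (P + Q)`, so by AM-GM
their product is at most `(P + Q) ^ 2`. -/
theorem harmonicMean_noise {P Q ξ : ℝ} (hP : 0 ≤ P) (hQ : 0 ≤ Q) (h0 : 0 ≤ ξ) (h1 : ξ ≤ 1) :
    (1 - ξ ^ 2) * harmonicMean P Q ≤
      harmonicMean (P * ((1 + ξ) / 2)) (Q * ((1 - ξ) / 2)) +
        harmonicMean (P * ((1 - ξ) / 2)) (Q * ((1 + ξ) / 2)) := by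
  have hnn : ∀ a b : ℝ, 0 ≤ a → 0 ≤ b → 0 ≤ harmonicMean a b := fun a b ha hb => by
    unfold harmonicMean; positivity
  have hξ : 0 ≤ 1 - ξ := by linarith
  rcases h1.eq_or_lt with rfl | h1
  · have e : (1 - (1 : ℝ) ^ 2) * harmonicMean P Q = 0 := by ring
    rw [e]
    exact add_nonneg (hnn _ _ (by positivity) (by positivity))
      (hnn _ _ (by positivity) (by positivity))
  rcases hP.eq_or_lt with rfl | hP
  · simp [harmonicMean]
  rcases hQ.eq_or_lt with rfl | hQ
  · simp [harmonicMean]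
  have hξ : 0 < 1 - ξ := by linarith
  have ha : 0 < P * (1 + ξ) + Q * (1 - ξ) := by positivity
  have hb : 0 < P * (1 - ξ) + Q * (1 + ξ) := by positivity
  have e : harmonicMean (P * ((1 + ξ) / 2)) (Q * ((1 - ξ) / 2)) +
        harmonicMean (P * ((1 - ξ) / 2)) (Q * ((1 + ξ) / 2)) =
      (1 - ξ ^ 2) * P * Q * (2 * (P + Q)) /
        ((P * (1 + ξ) + Q * (1 - ξ)) * (P * (1 - ξ) + Q * (1 + ξ))) := by
    have e1 : P * ((1 + ξ) / 2) + Q * ((1 - ξ) / 2) = (P * (1 + ξ) + Q * (1 - ξ)) / 2 := by ring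
    have e2 : P * ((1 - ξ) / 2) + Q * ((1 + ξ) / 2) = (P * (1 - ξ) + Q * (1 + ξ)) / 2 := by ring
    rw [harmonicMean, harmonicMean, e1, e2]
    field_simp
    ring
  rw [e, harmonicMean, mul_div_assoc', div_le_div_iff₀ (by positivity) (by positivity)]
  have key : (P * (1 + ξ) + Q * (1 - ξ)) * (P * (1 - ξ) + Q * (1 + ξ)) ≤ (P + Q) * (P + Q) := by
    nlinarith [mul_nonneg (sq_nonneg ξ) (sq_nonneg (P - Q))]
  have hc : 0 ≤ (1 - ξ ^ 2) * (2 * P * Q) := by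
    have : 0 ≤ 1 - ξ ^ 2 := by nlinarith
    positivity
  calc _ ≤ (1 - ξ ^ 2) * (2 * P * Q) * ((P + Q) * (P + Q)) :=
        mul_le_mul_of_nonneg_left key hc
    _ = _ := by ring

variable {I : Type*} [Fintype I]

/-- Tensorization: arbitrary prior weights `P`, `Q` let the induction absorb the first observation
into them. -/
theorem pow_mul_harmonicMean_le_sum {p q : I → ℝ} (hp : ∀ a, 0 ≤ p a) (hq : ∀ a, 0 ≤ q a) {c : ℝ}
    (hc : 0 ≤ c) (h : ∀ P Q : ℝ, 0 ≤ P → 0 ≤ Q →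
      c * harmonicMean P Q ≤ ∑ a, harmonicMean (P * p a) (Q * q a)) (n : ℕ) :
    ∀ P Q : ℝ, 0 ≤ P → 0 ≤ Q → c ^ n * harmonicMean P Q ≤
      ∑ s : Fin n → I, harmonicMean (P * ∏ k, p (s k)) (Q * ∏ k, q (s k)) := by
  induction n with
  | zero => intro P Q _ _; simp
  | succ n ih =>
    intro P Q hP hQ
    rw [← (Fin.consEquiv fun _ : Fin (n + 1) => I).sum_comp, Fintype.sum_prod_type]
    calc c ^ (n + 1) * harmonicMean P Q = c ^ n * (c * harmonicMean P Q) := by ring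
      _ ≤ c ^ n * ∑ a, harmonicMean (P * p a) (Q * q a) :=
        mul_le_mul_of_nonneg_left (h P Q hP hQ) (pow_nonneg hc n)
      _ = ∑ a, c ^ n * harmonicMean (P * p a) (Q * q a) := Finset.mul_sum _ _ _
      _ ≤ _ := by
        refine Finset.sum_le_sum fun a _ => ?_
        refine (ih _ _ (mul_nonneg hP (hp a)) (mul_nonneg hQ (hq a))).trans_eq ?_
        refine Finset.sum_congr rfl fun s _ => ?_
        simp only [Fin.consEquiv, Equiv.coe_fn_mk, Fin.prod_univ_succ, Fin.cons_zero,
          Fin.cons_succ, mul_assoc]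

end HarmonicMean

section Flip

variable {ι : Type*} [DecidableEq ι]

/-- Flips the label of `i`. -/
def flipAt (i : ι) (σ : ι → Bool) : ι → Bool := Function.update σ i (!σ i)

theorem flipAt_involutive (i : ι) : Function.Involutive (flipAt i) := fun σ => by
  simp [flipAt]

end Flip

/-! ### Assouad's argument on the hypercube of labellings -/

section Hypercube

variable {ι : Type*} [Fintype ι]

/-- The sign attached to a label. -/
def sgn (b : Bool) : ℝ := if b then 1 else -1

/-- The weights of the labelled points: each point `some i` has mass `w` and carries the label
`σ i` with probability `(1 + ξ) / 2`, the point `none` has the remaining mass and carries the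
label `true`. -/
def cubeWeight (w ξ : ℝ) (σ : ι → Bool) : Option ι × Bool → ℝ
  | (none, b) => if b then 1 - Fintype.card ι * w else 0
  | (some i, b) => w * ((1 + ξ * sgn b * sgn (σ i)) / 2)

theorem cubeWeight_nonneg {w ξ : ℝ} (hw : 0 ≤ w) (hw1 : Fintype.card ι * w ≤ 1) (h0 : 0 ≤ ξ)
    (h1 : ξ ≤ 1) (σ : ι → Bool) (a : Option ι × Bool) : 0 ≤ cubeWeight w ξ σ a := by
  obtain ⟨_ | i, b⟩ := a
  · simp only [cubeWeight]; split_ifs <;> linarith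
  · refine mul_nonneg hw ?_
    cases b <;> cases σ i <;> simp [sgn] <;> linarith

theorem sum_cubeWeight_some (w ξ : ℝ) (σ : ι → Bool) (i : ι) :
    ∑ b, cubeWeight w ξ σ (some i, b) = w := by
  simp only [Fintype.sum_bool, cubeWeight, sgn]
  cases σ i <;> simp <;> ring

theorem sum_cubeWeight (w ξ : ℝ) (σ : ι → Bool) : ∑ a, cubeWeight w ξ σ a = 1 := by
  rw [Fintype.sum_prod_type, Fintype.sum_option]
  simp only [sum_cubeWeight_some]
  simp [cubeWeight]

variable [DecidableEq ι]

theorem cubeWeight_flipAt_of_ne (w ξ : ℝ) (σ : ι → Bool) {i : ι} {a : Option ι × Bool}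
    (h : a.1 ≠ some i) : cubeWeight w ξ (flipAt i σ) a = cubeWeight w ξ σ a := by
  obtain ⟨_ | j, b⟩ := a
  · rfl
  · have : j ≠ i := fun hj => h (by rw [hj])
    simp [cubeWeight, flipAt, this]

/-- Both laws dominate their common restriction `r` away from the point `i`, which has mass `1 - w`;
samples missing `i` cannot reveal `σ i`. -/
theorem pow_le_sum_min {w ξ : ℝ} (hw : 0 ≤ w) (hw1 : Fintype.card ι * w ≤ 1) (h0 : 0 ≤ ξ)
    (h1 : ξ ≤ 1) (n : ℕ) (σ : ι → Bool) (i : ι) :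
    (1 - w) ^ n ≤ ∑ s : Fin n → Option ι × Bool,
      min (∏ k, cubeWeight w ξ σ (s k)) (∏ k, cubeWeight w ξ (flipAt i σ) (s k)) := by
  have hnn := cubeWeight_nonneg hw hw1 h0 h1
  set r : Option ι × Bool → ℝ := fun a => if a.1 = some i then 0 else cubeWeight w ξ σ a with hr
  have hr0 : ∀ a, 0 ≤ r a := fun a => by
    simp only [hr]; split_ifs; exacts [le_rfl, hnn σ a]
  have hr1 : ∀ a, r a ≤ cubeWeight w ξ σ a := fun a => by
    simp only [hr]; split_ifs; exacts [hnn σ a, le_rfl]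
  have hr2 : ∀ a, r a ≤ cubeWeight w ξ (flipAt i σ) a := fun a => by
    simp only [hr]; split_ifs with h
    exacts [hnn _ a, (cubeWeight_flipAt_of_ne w ξ σ h).ge]
  have hsum : ∑ a, r a = 1 - w := by
    have e : ∀ a, r a = cubeWeight w ξ σ a - if a.1 = some i then cubeWeight w ξ σ a else 0 :=
      fun a => by simp only [hr]; split_ifs <;> ring
    simp_rw [e, Finset.sum_sub_distrib, sum_cubeWeight]
    rw [Fintype.sum_prod_type]
    have e' : ∀ x : Option ι, (∑ b, if x = some i then cubeWeight w ξ σ (x, b) else 0) =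
        if x = some i then w else 0 := fun x => by
      split_ifs with h
      · rw [h, sum_cubeWeight_some]
      · simp
    simp only [e']
    simp
  rw [← hsum, Fintype.sum_pow]
  exact Finset.sum_le_sum fun s _ => le_min
    (Finset.prod_le_prod (fun k _ => hr0 _) fun k _ => hr1 _)
    (Finset.prod_le_prod (fun k _ => hr0 _) fun k _ => hr2 _)

/-- Away from `i` the laws agree and no affinity is lost; at `i`, of mass `w`, at most the fraction
`ξ ^ 2` is lost. -/
theorem mul_harmonicMean_le_sum_cubeWeight {w ξ : ℝ} (hw : 0 ≤ w) (h0 : 0 ≤ ξ) (h1 : ξ ≤ 1)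
    (σ : ι → Bool) (i : ι) (P Q : ℝ) (hP : 0 ≤ P) (hQ : 0 ≤ Q) :
    (1 - w * ξ ^ 2) * harmonicMean P Q ≤
      ∑ a, harmonicMean (P * cubeWeight w ξ σ a) (Q * cubeWeight w ξ (flipAt i σ) a) := by
  rw [Fintype.sum_prod_type]
  have hT : ∑ x : Option ι, ((∑ b, cubeWeight w ξ σ (x, b)) - if x = some i then w * ξ ^ 2 else 0)
      = 1 - w * ξ ^ 2 := by
    rw [Finset.sum_sub_distrib, ← Fintype.sum_prod_type, sum_cubeWeight]
    simp
  rw [← hT, Finset.sum_mul]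
  refine Finset.sum_le_sum fun x _ => ?_
  by_cases hx : x = some i
  · subst hx
    have hn := mul_le_mul_of_nonneg_left (harmonicMean_noise hP hQ h0 h1) hw
    rw [mul_add, ← harmonicMean_mul_right (P * ((1 + ξ) / 2)),
      ← harmonicMean_mul_right (P * ((1 - ξ) / 2))] at hn
    cases hσ : σ i
    · rw [sum_cubeWeight_some]
      simp only [if_true, Fintype.sum_bool, cubeWeight, flipAt, Function.update_self, hσ, sgn]
      simp only [Bool.not_false, if_true, Bool.false_eq_true, if_false]
      convert hn using 1
      · ring
      · rw [add_comm]; congr 1 <;> congr 1 <;> ring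
    · rw [sum_cubeWeight_some]
      simp only [if_true, Fintype.sum_bool, cubeWeight, flipAt, Function.update_self, hσ, sgn]
      simp only [Bool.not_true, Bool.false_eq_true, if_false]
      convert hn using 1
      · ring
      · congr 1 <;> congr 1 <;> ring
  · rw [if_neg hx, sub_zero, Finset.sum_mul]
    refine Finset.sum_le_sum fun b _ => ?_
    rw [cubeWeight_flipAt_of_ne w ξ σ (a := (x, b)) hx, harmonicMean_mul_right]

/-- Bernoulli's inequality keeps the affinity of the samples above `3 / 4`, and passing to the
minimum costs `(1 + 1) / 8`. -/
theorem half_le_sum_min {w ξ : ℝ} (hw : 0 ≤ w) (hw1 : Fintype.card ι * w ≤ 1) (h0 : 0 ≤ ξ)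
    (h1 : ξ ≤ 1) (n : ℕ) (hn : n * (w * ξ ^ 2) ≤ 1 / 4) (hwξ : w * ξ ^ 2 ≤ 1)
    (σ : ι → Bool) (i : ι) :
    1 / 2 ≤ ∑ s : Fin n → Option ι × Bool,
      min (∏ k, cubeWeight w ξ σ (s k)) (∏ k, cubeWeight w ξ (flipAt i σ) (s k)) := by
  have hnn := cubeWeight_nonneg hw hw1 h0 h1
  have hH := pow_mul_harmonicMean_le_sum (hnn σ) (hnn (flipAt i σ)) (c := 1 - w * ξ ^ 2)
    (by linarith) (mul_harmonicMean_le_sum_cubeWeight hw h0 h1 σ i) n 1 1 zero_le_one zero_le_one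
  have hB := one_add_mul_le_pow (a := -(w * ξ ^ 2)) (by linarith) n
  have hone : harmonicMean 1 1 = 1 := by norm_num [harmonicMean]
  simp only [one_mul, hone, mul_one] at hH
  have hs : ∀ τ : ι → Bool, ∑ s : Fin n → Option ι × Bool, ∏ k, cubeWeight w ξ τ (s k) = 1 :=
    fun τ => by rw [← Fintype.sum_pow, sum_cubeWeight, one_pow]
  have hmin := Finset.sum_le_sum fun (s : Fin n → Option ι × Bool) (_ : s ∈ Finset.univ) =>
    harmonicMean_sub_le_min (Finset.prod_nonneg fun k (_ : k ∈ Finset.univ) => hnn σ (s k))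
      (Finset.prod_nonneg fun k (_ : k ∈ Finset.univ) => hnn (flipAt i σ) (s k))
  rw [Finset.sum_sub_distrib, ← Finset.sum_div, Finset.sum_add_distrib, hs, hs] at hmin
  have e : (1 - w * ξ ^ 2) ^ n = (1 + -(w * ξ ^ 2)) ^ n := by rw [sub_eq_add_neg]
  linarith

/-- On the common part `min P Q` the biases cancel and leave `u + v ≥ 2 * C`; the surplus of the
larger weight is charged its noise floor `φ * C`. -/
theorem two_point_lower_bound {P Q u v ξ φ C : ℝ} (hP : 0 ≤ P) (hQ : 0 ≤ Q)
    (huv : 2 * C ≤ u + v) (h1 : φ * C ≤ (1 + ξ) / 2 * u + (1 - ξ) / 2 * v)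
    (h2 : φ * C ≤ (1 - ξ) / 2 * u + (1 + ξ) / 2 * v) :
    ((P + Q) * φ + 2 * min P Q * (1 - φ)) * C ≤
      P * ((1 + ξ) / 2 * u + (1 - ξ) / 2 * v) + Q * ((1 - ξ) / 2 * u + (1 + ξ) / 2 * v) := by
  rcases le_total P Q with h | h
  · rw [min_eq_left h]
    nlinarith [mul_le_mul_of_nonneg_left huv hP, mul_le_mul_of_nonneg_left h2 (sub_nonneg.2 h)]
  · rw [min_eq_right h]
    nlinarith [mul_le_mul_of_nonneg_left huv hQ, mul_le_mul_of_nonneg_left h1 (sub_nonneg.2 h)]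

/-- For each `i`, pairing `σ` with `flipAt i σ` bounds the average over `σ` of the loss at `i`. Some
`σ` does at least as badly as the average of the sum over `i`; the loss at `none` is dropped. -/
theorem exists_cube_lower_bound {n : ℕ} {w ξ φ C M : ℝ} (hw : 0 ≤ w)
    (hw1 : Fintype.card ι * w ≤ 1) (h0 : 0 ≤ ξ) (h1 : ξ ≤ 1) (hC : 0 ≤ C) (hφ : φ ≤ 1)
    (hM : ∀ (σ : ι → Bool) (i : ι), M ≤ ∑ s : Fin n → Option ι × Bool,
      min (∏ k, cubeWeight w ξ σ (s k)) (∏ k, cubeWeight w ξ (flipAt i σ) (s k)))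
    (L : (Fin n → Option ι × Bool) → Option ι × Bool → ℝ) (hL : ∀ s a, 0 ≤ L s a)
    (hL0 : ∀ s i, 2 * C ≤ L s (some i, true) + L s (some i, false))
    (hL1 : ∀ s i, φ * C ≤ (1 + ξ) / 2 * L s (some i, true) + (1 - ξ) / 2 * L s (some i, false))
    (hL2 : ∀ s i, φ * C ≤ (1 - ξ) / 2 * L s (some i, true) + (1 + ξ) / 2 * L s (some i, false)) :
    ∃ σ : ι → Bool, Fintype.card ι * w * (φ + (1 - φ) * M) * C ≤
      ∑ s : Fin n → Option ι × Bool, (∏ k, cubeWeight w ξ σ (s k)) *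
        ∑ a, cubeWeight w ξ σ a * L s a := by
  have hnn := cubeWeight_nonneg hw hw1 h0 h1
  have hs : ∀ τ : ι → Bool, ∑ s : Fin n → Option ι × Bool, ∏ k, cubeWeight w ξ τ (s k) = 1 :=
    fun τ => by rw [← Fintype.sum_pow, sum_cubeWeight, one_pow]
  set A : ι → (ι → Bool) → ℝ := fun i σ => ∑ s : Fin n → Option ι × Bool,
    (∏ k, cubeWeight w ξ σ (s k)) * ∑ b, cubeWeight w ξ σ (some i, b) * L s (some i, b) with hA
  have hpair : ∀ i σ, 2 * (w * (φ + (1 - φ) * M) * C) ≤ A i σ + A i (flipAt i σ) := by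
    intro i σ
    have hsum : ∑ s : Fin n → Option ι × Bool,
        w * ((((∏ k, cubeWeight w ξ σ (s k)) + ∏ k, cubeWeight w ξ (flipAt i σ) (s k)) * φ +
          2 * min (∏ k, cubeWeight w ξ σ (s k)) (∏ k, cubeWeight w ξ (flipAt i σ) (s k)) *
            (1 - φ)) * C) ≤ A i σ + A i (flipAt i σ) := by
      rw [hA, ← Finset.sum_add_distrib]
      refine Finset.sum_le_sum fun s _ => ?_
      have hP : 0 ≤ ∏ k, cubeWeight w ξ σ (s k) := Finset.prod_nonneg fun k _ => hnn _ _
      have hQ : 0 ≤ ∏ k, cubeWeight w ξ (flipAt i σ) (s k) :=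
        Finset.prod_nonneg fun k _ => hnn _ _
      generalize ∏ k, cubeWeight w ξ σ (s k) = P at hP ⊢
      generalize ∏ k, cubeWeight w ξ (flipAt i σ) (s k) = Q at hQ ⊢
      cases hσ : σ i
      · simp only [Fintype.sum_bool, cubeWeight, flipAt, Function.update_self, hσ, sgn]
        simp only [Bool.not_false, if_true, Bool.false_eq_true, if_false]
        have := mul_le_mul_of_nonneg_left
          (two_point_lower_bound hQ hP (hL0 s i) (hL1 s i) (hL2 s i)) hw
        rw [min_comm, add_comm P Q]
        refine this.trans_eq ?_
        ring
      · simp only [Fintype.sum_bool, cubeWeight, flipAt, Function.update_self, hσ, sgn]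
        simp only [Bool.not_true, if_true, Bool.false_eq_true, if_false]
        have := mul_le_mul_of_nonneg_left
          (two_point_lower_bound hP hQ (hL0 s i) (hL1 s i) (hL2 s i)) hw
        refine this.trans_eq ?_
        ring
    refine le_trans ?_ hsum
    rw [← Finset.mul_sum, ← Finset.sum_mul, Finset.sum_add_distrib, ← Finset.sum_mul,
      Finset.sum_add_distrib, hs, hs, ← Finset.sum_mul, ← Finset.mul_sum]
    have := mul_le_mul_of_nonneg_left (hM σ i)
      (mul_nonneg (mul_nonneg hw hC) (sub_nonneg.2 hφ))
    nlinarith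
  have hcoord : ∀ i, ∑ _σ : ι → Bool, w * (φ + (1 - φ) * M) * C ≤ ∑ σ, A i σ := by
    intro i
    have hflip : ∑ σ, A i (flipAt i σ) = ∑ σ, A i σ :=
      Equiv.sum_comp (flipAt_involutive i).toPerm (A i)
    have := Finset.sum_le_sum fun σ (_ : σ ∈ Finset.univ) => hpair i σ
    rw [Finset.sum_add_distrib, hflip, ← Finset.mul_sum] at this
    linarith
  have htot : ∑ _σ : ι → Bool, Fintype.card ι * w * (φ + (1 - φ) * M) * C ≤
      ∑ σ, ∑ i, A i σ := by
    rw [Finset.sum_comm]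
    refine le_trans (le_of_eq ?_) (Finset.sum_le_sum fun i (_ : i ∈ Finset.univ) => hcoord i)
    simp only [Finset.sum_const, nsmul_eq_mul, Finset.card_univ]
    ring
  obtain ⟨σ, -, hσ⟩ := Finset.exists_le_of_sum_le Finset.univ_nonempty htot
  refine ⟨σ, hσ.trans ?_⟩
  rw [hA, Finset.sum_comm]
  refine Finset.sum_le_sum fun s _ => ?_
  rw [← Finset.mul_sum]
  refine mul_le_mul_of_nonneg_left ?_ (Finset.prod_nonneg fun k _ => hnn _ _)
  rw [Fintype.sum_prod_type, Fintype.sum_option]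
  exact le_add_of_nonneg_left (Finset.sum_nonneg fun b _ => mul_nonneg (hnn _ _) (hL _ _))

end Hypercube

theorem exists_embedding_of_card_le {X : Type*} {k : ℕ}
    (h : (k : ℕ∞) ≤ ENat.card X) :
    ∃ x : Fin k → X, Function.Injective x := by
  cases finite_or_infinite X
  · have := Fintype.ofFinite X
    rw [ENat.card_eq_coe_fintype_card, Nat.cast_le] at h
    obtain ⟨e⟩ := Function.Embedding.nonempty_of_card_le
      (show Fintype.card (Fin k) ≤ Fintype.card X by simpa using h)
    exact ⟨e, e.injective⟩
  · exact ⟨fun i => Infinite.natEmbedding X i,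
      (Infinite.natEmbedding X).injective.comp Fin.val_injective⟩

/-! ### Realizing the hypercube by prediction functions -/

section Interpolation

variable {X : Type u} [MeasurableSpace X]

/-- Finite intersections of separating sets isolate each node measurably, and the values are then
glued in one node at a time. -/
theorem exists_measurable_interpolation [MeasurableSpace.SeparatesPoints X] {κ : Type*} [Finite κ]
    {x : κ → X} (hx : Function.Injective x) {Y : Type*} [MeasurableSpace Y] [Nonempty Y]
    (v : κ → Y) : ∃ g : X → Y, Measurable g ∧ ∀ i, g (x i) = v i := by
  classical
  have := Fintype.ofFinite κ
  have hsep : ∀ i j, ∃ s : Set X, MeasurableSet s ∧ x i ∈ s ∧ (i ≠ j → x j ∉ s) := by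
    intro i j
    by_cases h : i = j
    · exact ⟨Set.univ, MeasurableSet.univ, Set.mem_univ _, fun h' => absurd h h'⟩
    · obtain ⟨s, h1, h2, h3⟩ := MeasurableSpace.exists_measurableSet_of_ne (hx.ne h)
      exact ⟨s, h1, h2, fun _ => h3⟩
  choose s hs1 hs2 hs3 using hsep
  have hA : ∀ i, MeasurableSet (⋂ j, s i j) := fun i => MeasurableSet.iInter fun j => hs1 i j
  have key : ∀ T : Finset κ, ∃ g : X → Y, Measurable g ∧ ∀ i ∈ T, g (x i) = v i := by
    intro T
    induction T using Finset.induction_on with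
    | empty => exact ⟨fun _ => Classical.arbitrary Y, measurable_const, by simp⟩
    | insert a T ha ih =>
      obtain ⟨g, hg, hgv⟩ := ih
      refine ⟨(⋂ j, s a j).piecewise (fun _ => v a) g, measurable_const.piecewise (hA a) hg, ?_⟩
      intro i hi
      by_cases hia : i = a
      · subst hia
        exact Set.piecewise_eq_of_mem _ _ _ (Set.mem_iInter.2 fun j => hs2 i j)
      · rw [Set.piecewise_eq_of_notMem]
        · exact hgv i (Finset.mem_of_mem_insert_of_ne hi hia)
        · exact fun h => hs3 a i (Ne.symm hia) (Set.mem_iInter.1 h i)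
  obtain ⟨g, hg, hgv⟩ := key Finset.univ
  exact ⟨g, hg, fun i => hgv i (Finset.mem_univ i)⟩

/-- Pads the family to exactly `d` functions. Padding is harmless: enlarging `G` can only lower the
best risk in it. -/
theorem exists_finset_card_eq_of_family [Nonempty X] {B : ℝ} (hB : 0 < B) {m d : ℕ}
    (hmd : 2 ^ m ≤ d) (F : (Fin m → Bool) → PredictionFunction X B) :
    ∃ G : Finset (PredictionFunction X B), G.card = d ∧ ∀ σ, F σ ∈ G := by
  classical
  have : Infinite (Set.Icc (-B) B) := Set.infinite_coe_iff.2 (Set.Icc_infinite (by linarith))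
  have : Infinite (PredictionFunction X B) := by
    refine Infinite.of_injective
      (fun c : Set.Icc (-B) B => (⟨fun _ => c, measurable_const⟩ : PredictionFunction X B)) ?_
    intro a b h
    exact congrFun (congrArg Subtype.val h) (Classical.arbitrary X)
  have hc : (Finset.univ.image F).card ≤ d := by
    refine Finset.card_image_le.trans ?_
    simpa using hmd
  obtain ⟨G, hG, hGd⟩ := Infinite.exists_superset_card_eq _ _ hc
  exact ⟨G, hGd, fun σ => hG (Finset.mem_image_of_mem F (Finset.mem_univ σ))⟩

end Interpolation

/-! ### The one-point problem with a noisy label -/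

section NoisyLoss

/-- The normalized risk of the constant prediction `t` when the label is `1` with probability
`(1 + ξ) / 2` and `-1` otherwise. -/
def noisyLoss (q ξ t : ℝ) : ℝ := (1 + ξ) / 2 * (1 - t) ^ q + (1 - ξ) / 2 * (1 + t) ^ q

theorem exists_isMinOn_noisyLoss {q : ℝ} (hq : 1 ≤ q) (ξ : ℝ) :
    ∃ h ∈ Set.Icc (-1 : ℝ) 1, ∀ t ∈ Set.Icc (-1 : ℝ) 1, noisyLoss q ξ h ≤ noisyLoss q ξ t := by
  have hq0 : 0 ≤ q := by linarith
  have hc : Continuous (noisyLoss q ξ) := by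
    unfold noisyLoss
    exact (continuous_const.mul ((continuous_const.sub continuous_id).rpow_const
      fun _ => Or.inr hq0)).add (continuous_const.mul
      ((continuous_const.add continuous_id).rpow_const fun _ => Or.inr hq0))
  obtain ⟨h, hh, hmin⟩ := isCompact_Icc.exists_isMinOn (Set.nonempty_Icc.2 (by norm_num))
    hc.continuousOn (s := Set.Icc (-1 : ℝ) 1)
  exact ⟨h, hh, fun t ht => hmin ht⟩

theorem noisyLoss_neg (q ξ t : ℝ) :
    noisyLoss q ξ (-t) = (1 - ξ) / 2 * (1 - t) ^ q + (1 + ξ) / 2 * (1 + t) ^ q := by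
  rw [noisyLoss, sub_neg_eq_add, ← sub_eq_add_neg, add_comm]

theorem noisyLoss_zero (q ξ : ℝ) : noisyLoss q ξ 0 = 1 := by
  simp [noisyLoss]; ring

theorem noisyLoss_one {q : ℝ} (hq : 1 ≤ q) (ξ : ℝ) :
    noisyLoss q ξ 1 = (1 - ξ) * 2 ^ (q - 1) := by
  rw [noisyLoss, sub_self, Real.zero_rpow (by linarith), one_add_one_eq_two,
    Real.rpow_sub_one (by norm_num)]
  ring

theorem two_le_one_sub_rpow_add_one_add_rpow {q t : ℝ} (hq : 1 ≤ q)
    (ht : t ∈ Set.Icc (-1 : ℝ) 1) : 2 ≤ (1 - t) ^ q + (1 + t) ^ q := by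
  have h1 := one_add_mul_self_le_rpow_one_add (s := -t) (by linarith [ht.2]) hq
  have h2 := one_add_mul_self_le_rpow_one_add ht.1 hq
  rw [← sub_eq_add_neg] at h1
  linarith

/-- Since `2 ^ (q - 1) ≤ 2 ^ ξ ≤ 1 + 0.7 * ξ + 0.4 * ξ ^ 2`, the gap is at least `0.3 * ξ * (1 +
ξ)`, well above `q * ξ / 10`. -/
theorem mul_div_ten_le_one_sub_noisyLoss_one {q ξ : ℝ} (hq : 1 ≤ q) (hqξ : q ≤ 1 + ξ)
    (hξ : ξ ≤ 1) : q * ξ / 10 ≤ 1 - noisyLoss q ξ 1 := by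
  have h0 : 0 ≤ ξ := by linarith
  rw [noisyLoss_one hq]
  have hpow : (2 : ℝ) ^ (q - 1) ≤ Real.exp (0.6931471808 * ξ) := by
    rw [Real.rpow_def_of_pos (by norm_num)]
    refine Real.exp_le_exp.2 ?_
    have := Real.log_two_lt_d9
    have := Real.log_pos one_lt_two
    nlinarith
  have hexp : Real.exp (0.6931471808 * ξ) ≤ 1 + 0.7 * ξ + 0.4 * ξ ^ 2 := by
    have := Real.exp_bound' (x := 0.6931471808 * ξ) (by positivity) (by linarith) (n := 3)
      (by norm_num)
    norm_num [Finset.sum_range_succ, Nat.factorial] at this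
    have h2 : 0 ≤ ξ ^ 2 * (1 - ξ) := mul_nonneg (sq_nonneg _) (by linarith)
    nlinarith [sq_nonneg ξ]
  have h1 : (1 - ξ) * (2 : ℝ) ^ (q - 1) ≤ (1 - ξ) * (1 + 0.7 * ξ + 0.4 * ξ ^ 2) :=
    mul_le_mul_of_nonneg_left (hpow.trans hexp) (by linarith)
  have h2 : q * ξ ≤ (1 + ξ) * ξ := mul_le_mul_of_nonneg_right hqξ h0
  nlinarith [mul_nonneg (sq_nonneg ξ) h0, sq_nonneg ξ]

end NoisyLoss

/-! ### The excess risk bound with free parameters -/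

section LowerBound

variable {X : Type u} [MeasurableSpace X] {B : ℝ} {n m : ℕ}

theorem sgn_mul_mem_Icc (hB : 0 < B) {h : ℝ} (hh : h ∈ Set.Icc (-1 : ℝ) 1) (b : Bool) :
    sgn b * h * B ∈ Set.Icc (-B) B := by
  have h1 : -B ≤ h * B := by nlinarith [hh.1]
  have h2 : h * B ≤ B := by nlinarith [hh.2]
  cases b
  · simp only [sgn, Bool.false_eq_true, if_false, Set.mem_Icc]
    constructor <;> linarith
  · simp only [sgn, if_true, Set.mem_Icc]
    constructor <;> linarith

/-- The labelled point attached to an index: the label is `B` or `-B`. -/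
def labelledPoint (hB : 0 < B) (x : Option (Fin m) → X) (a : Option (Fin m) × Bool) : Data X B :=
  (x a.1, ⟨sgn a.2 * 1 * B, sgn_mul_mem_Icc hB (by norm_num) a.2⟩)

theorem risk_cubeWeight (hB : 0 < B) {q w ξ h : ℝ} (hq : 1 ≤ q) (hw : 0 ≤ w)
    (hw1 : m * w ≤ 1) (h0 : 0 ≤ ξ) (h1 : ξ ≤ 1) (hh : h ∈ Set.Icc (-1 : ℝ) 1)
    (x : Option (Fin m) → X) (σ : Fin m → Bool) (g : PredictionFunction X B)
    (hg : ∀ i, (g.1 (x (some i)) : ℝ) = sgn (σ i) * h * B)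
    (hg0 : m * w = 1 ∨ (g.1 (x none) : ℝ) = B) :
    risk q (discreteLaw (cubeWeight w ξ σ) (labelledPoint hB x)) g.1 =
      m * w * noisyLoss q ξ h * B ^ q := by
  have hw1' : Fintype.card (Fin m) * w ≤ 1 := by simpa using hw1
  rw [risk_discreteLaw (cubeWeight_nonneg hw hw1' h0 h1 σ) _ q g.2, Fintype.sum_prod_type,
    Fintype.sum_option]
  have e1 : |B - h * B| ^ q = (1 - h) ^ q * B ^ q := by
    rw [← Real.mul_rpow (by linarith [hh.2]) hB.le, abs_of_nonneg (by nlinarith [hh.2])]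
    ring_nf
  have e2 : |-B - h * B| ^ q = (1 + h) ^ q * B ^ q := by
    rw [← Real.mul_rpow (by linarith [hh.1]) hB.le, abs_of_nonpos (by nlinarith [hh.1])]
    ring_nf
  have e3 : |B - -(h * B)| ^ q = (1 + h) ^ q * B ^ q := by
    rw [← e2, ← abs_neg]; ring_nf
  have e4 : |-B - -(h * B)| ^ q = (1 - h) ^ q * B ^ q := by
    rw [← e1, ← abs_neg]; ring_nf
  have hnone : ∑ b, cubeWeight w ξ σ (none, b) *
      |((labelledPoint hB x (none, b)).2 : ℝ) - (g.1 (labelledPoint hB x (none, b)).1 : ℝ)| ^ q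
      = 0 := by
    rw [Fintype.sum_bool]
    simp only [cubeWeight, labelledPoint, sgn, if_true, Bool.false_eq_true, if_false, zero_mul,
      add_zero, one_mul, Fintype.card_fin]
    rcases hg0 with hg0 | hg0
    · rw [hg0, sub_self, zero_mul]
    · rw [hg0, sub_self, abs_zero, Real.zero_rpow (by linarith), mul_zero]
  have hsome : ∀ i, ∑ b, cubeWeight w ξ σ (some i, b) *
      |((labelledPoint hB x (some i, b)).2 : ℝ) -
        (g.1 (labelledPoint hB x (some i, b)).1 : ℝ)| ^ q = w * noisyLoss q ξ h * B ^ q := by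
    intro i
    rw [Fintype.sum_bool]
    simp only [labelledPoint, hg, cubeWeight]
    cases σ i
    · simp only [sgn, if_true, Bool.false_eq_true, if_false, one_mul, neg_mul,
        e3, e4, noisyLoss]
      ring
    · simp only [sgn, if_true, Bool.false_eq_true, if_false, one_mul, neg_mul,
        e1, e2, noisyLoss]
      ring
  rw [hnone, zero_add, Finset.sum_congr rfl fun i _ => hsome i]
  simp
  ring

theorem exists_law_excessRisk_lower_bound (hB : 0 < B) {q w ξ h M : ℝ} (hq : 1 ≤ q) (hw : 0 ≤ w)
    (hw1 : m * w ≤ 1) (h0 : 0 ≤ ξ) (h1 : ξ ≤ 1) (hh : h ∈ Set.Icc (-1 : ℝ) 1)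
    (hmin : ∀ t ∈ Set.Icc (-1 : ℝ) 1, noisyLoss q ξ h ≤ noisyLoss q ξ t)
    (hM : ∀ (σ : Fin m → Bool) (i : Fin m), M ≤ ∑ s : Fin n → Option (Fin m) × Bool,
      min (∏ k, cubeWeight w ξ σ (s k)) (∏ k, cubeWeight w ξ (flipAt i σ) (s k)))
    (x : Option (Fin m) → X) (F : (Fin m → Bool) → PredictionFunction X B)
    (hF : ∀ σ i, ((F σ).1 (x (some i)) : ℝ) = sgn (σ i) * h * B)
    (hF0 : ∀ σ, m * w = 1 ∨ ((F σ).1 (x none) : ℝ) = B)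
    (G : Finset (PredictionFunction X B)) (hG : ∀ σ, F σ ∈ G) (f : Estimator.{u, w} X B n) :
    ∃ P : Measure (Data X B), IsProbabilityMeasure P ∧
      m * w * (1 - noisyLoss q ξ h) * M * B ^ q ≤ f.excessRisk q P G := by
  have hq0 : 0 ≤ q := by linarith
  have hw1' : Fintype.card (Fin m) * w ≤ 1 := by simpa using hw1
  have hφ : noisyLoss q ξ h ≤ 1 := by
    have := hmin 0 (by norm_num)
    rwa [noisyLoss_zero] at this
  have hloss := fun (c a b : ℝ) (hc : ∀ t ∈ Set.Icc (-1 : ℝ) 1,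
      c ≤ a * (1 - t) ^ q + b * (1 + t) ^ q) (s : Fin n → Option (Fin m) × Bool) (i : Fin m) =>
    f.const_le_weighted_pointLoss hq0 hB (fun k => labelledPoint hB x (s k)) hc (x (some i))
      (y := ⟨sgn true * 1 * B, sgn_mul_mem_Icc hB (by norm_num) true⟩)
      (y' := ⟨sgn false * 1 * B, sgn_mul_mem_Icc hB (by norm_num) false⟩)
      (by simp [sgn]) (by simp [sgn])
  obtain ⟨σ, hσ⟩ := exists_cube_lower_bound (n := n) (C := B ^ q) (φ := noisyLoss q ξ h)
    hw hw1' h0 h1 (Real.rpow_nonneg hB.le q) hφ hM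
    (fun s a => f.pointLoss q (fun k => labelledPoint hB x (s k)) (labelledPoint hB x a))
    (fun s a => integral_nonneg fun θ => Real.rpow_nonneg (abs_nonneg _) q)
    (fun s i => by
      have := hloss 2 1 1 (fun t ht => by
        rw [one_mul, one_mul]; exact two_le_one_sub_rpow_add_one_add_rpow hq ht) s i
      rw [one_mul, one_mul] at this
      exact this)
    (fun s i => hloss _ _ _ hmin s i)
    -- Reversing the bias amounts to `t ↦ -t`, so the same floor holds.
    (fun s i => hloss _ _ _ (fun t ht => by
      rw [← noisyLoss_neg]
      exact hmin _ ⟨by linarith [ht.2], by linarith [ht.1]⟩) s i)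
  have hnn := cubeWeight_nonneg hw hw1' h0 h1 σ
  refine ⟨discreteLaw (cubeWeight w ξ σ) (labelledPoint hB x),
    isProbabilityMeasure_discreteLaw hnn (sum_cubeWeight w ξ σ) _, ?_⟩
  rw [← f.expectedRisk_discreteLaw hnn (sum_cubeWeight w ξ σ) _ hq0, Fintype.card_fin] at hσ
  have hinf : ⨅ g : G, risk q (discreteLaw (cubeWeight w ξ σ) (labelledPoint hB x)) g.1.1 ≤
      m * w * noisyLoss q ξ h * B ^ q := by
    rw [← risk_cubeWeight hB hq hw hw1 h0 h1 hh x σ (F σ) (hF σ) (hF0 σ)]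
    exact ciInf_le (f := fun g : G =>
      risk q (discreteLaw (cubeWeight w ξ σ) (labelledPoint hB x)) g.1.1)
      (Set.finite_range _).bddBelow ⟨F σ, hG σ⟩
  rw [Estimator.excessRisk]
  linarith

theorem exists_finset_excessRisk_lower_bound [Nonempty X] (hB : 0 < B) {q w ξ M : ℝ} {d : ℕ}
    (hmd : 2 ^ m ≤ d) (hq : 1 ≤ q) (hw : 0 ≤ w) (hw1 : m * w ≤ 1) (h0 : 0 ≤ ξ) (h1 : ξ ≤ 1)
    (hM0 : 0 ≤ M)
    (hM : ∀ (σ : Fin m → Bool) (i : Fin m), M ≤ ∑ s : Fin n → Option (Fin m) × Bool,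
      min (∏ k, cubeWeight w ξ σ (s k)) (∏ k, cubeWeight w ξ (flipAt i σ) (s k)))
    (x : Option (Fin m) → X)
    (hx : ∀ v : Option (Fin m) → Set.Icc (-B) B, ∃ g : X → Set.Icc (-B) B, Measurable g ∧
      (∀ i, g (x (some i)) = v (some i)) ∧ (m * w = 1 ∨ g (x none) = v none)) :
    ∃ G : Finset (PredictionFunction X B), G.card = d ∧ ∀ f : Estimator.{u, w} X B n,
      ∃ P : Measure (Data X B), IsProbabilityMeasure P ∧
        m * w * (1 - noisyLoss q ξ 1) * M * B ^ q ≤ f.excessRisk q P G := by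
  obtain ⟨h, hh, hmin⟩ := exists_isMinOn_noisyLoss hq ξ
  choose g hg hgv hg0 using fun σ : Fin m → Bool => hx fun o => Option.elim o
    ⟨B, ⟨by linarith, le_rfl⟩⟩ fun i => ⟨sgn (σ i) * h * B, sgn_mul_mem_Icc hB hh (σ i)⟩
  obtain ⟨G, hGd, hG⟩ := exists_finset_card_eq_of_family hB hmd fun σ => ⟨g σ, hg σ⟩
  refine ⟨G, hGd, fun f => ?_⟩
  obtain ⟨P, hP, hle⟩ := exists_law_excessRisk_lower_bound hB hq hw hw1 h0 h1 hh hmin hM x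
    (fun σ => ⟨g σ, hg σ⟩) (fun σ i => by simp [hgv]) (fun σ => (hg0 σ).imp_right fun e => by
      simp [e]) G hG f
  refine ⟨P, hP, le_trans ?_ hle⟩
  -- Comparing with `t = 1` replaces the inexplicit minimum by a closed form.
  have := hmin 1 (by norm_num)
  gcongr

/-- Covers `Nat.log 2 d = 0`, where the mass `1 / m` makes no sense but the claimed bound is zero.
-/
theorem exists_finset_excessRisk_nonneg [Nonempty X] {q : ℝ} {d : ℕ} (hB : 0 < B)
    (hd : 0 < d) (hq : 1 ≤ q) :
    ∃ G : Finset (PredictionFunction X B), G.card = d ∧ ∀ f : Estimator.{u, w} X B n,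
      ∃ P : Measure (Data X B), IsProbabilityMeasure P ∧ 0 ≤ f.excessRisk q P G := by
  have key := exists_finset_excessRisk_lower_bound (X := X) (n := n) (m := 0) (w := 0) (ξ := 0)
    (M := 0) hB (d := d) hd hq le_rfl (by simp) le_rfl zero_le_one le_rfl
    (fun _ i => i.elim0) (fun _ => Classical.arbitrary X)
    (fun v => ⟨fun _ => v none, measurable_const, fun i => i.elim0, Or.inr rfl⟩)
  simpa using key

end LowerBound

/-! ### Choice of the mass and the bias in each regime -/

section Cases

variable {X : Type u} [MeasurableSpace X] [MeasurableSpace.SeparatesPoints X] [Nonempty X]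
  {B q : ℝ} {d n : ℕ}

theorem exists_finset_of_uniform (hB : 0 < B) (hd : 0 < d) (hq : 1 ≤ q) {ξ M : ℝ} (h0 : 0 ≤ ξ)
    (h1 : ξ ≤ 1) (hm : 0 < Nat.log 2 d) (hX : (Nat.log 2 d : ℕ∞) ≤ ENat.card X) (hM0 : 0 ≤ M)
    (hM : ∀ (σ : Fin (Nat.log 2 d) → Bool) (i : Fin (Nat.log 2 d)),
      M ≤ ∑ s : Fin n → Option (Fin (Nat.log 2 d)) × Bool,
        min (∏ k, cubeWeight (1 / (Nat.log 2 d : ℝ)) ξ σ (s k))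
          (∏ k, cubeWeight (1 / (Nat.log 2 d : ℝ)) ξ (flipAt i σ) (s k))) :
    ∃ G : Finset (PredictionFunction X B), G.card = d ∧ ∀ f : Estimator.{u, w} X B n,
      ∃ P : Measure (Data X B), IsProbabilityMeasure P ∧
        (1 - noisyLoss q ξ 1) * M * B ^ q ≤ f.excessRisk q P G := by
  obtain ⟨x, hx⟩ := exists_embedding_of_card_le hX
  have hmw : (Nat.log 2 d : ℝ) * (1 / (Nat.log 2 d : ℝ)) = 1 := by
    have : (Nat.log 2 d : ℝ) ≠ 0 := by positivity
    field_simp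
  have : Nonempty (Set.Icc (-B) B) := ⟨⟨B, by linarith, le_rfl⟩⟩
  have key := exists_finset_excessRisk_lower_bound (X := X) (n := n) hB
    (Nat.pow_log_le_self 2 hd.ne') hq (by positivity) hmw.le h0 h1 hM0 hM
    -- With `w = 1 / m` the extra point has no mass, so it may coincide with another node and only
    -- `m` points are needed.
    (fun o => o.elim (x ⟨0, hm⟩) x) (fun v => by
      obtain ⟨g, hg, hgv⟩ := exists_measurable_interpolation hx fun i => v (some i)
      exact ⟨g, hg, hgv, Or.inl hmw⟩)
  rw [hmw, one_mul] at key
  exact key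

theorem exists_finset_of_extra_point (hB : 0 < B) (hd : 0 < d) (hq : 1 ≤ q) {w ξ M : ℝ}
    (hw : 0 ≤ w) (hw1 : Nat.log 2 d * w ≤ 1) (h0 : 0 ≤ ξ) (h1 : ξ ≤ 1)
    (hX : (Nat.log 2 (2 * d) : ℕ∞) ≤ ENat.card X) (hM0 : 0 ≤ M)
    (hM : ∀ (σ : Fin (Nat.log 2 d) → Bool) (i : Fin (Nat.log 2 d)),
      M ≤ ∑ s : Fin n → Option (Fin (Nat.log 2 d)) × Bool,
        min (∏ k, cubeWeight w ξ σ (s k)) (∏ k, cubeWeight w ξ (flipAt i σ) (s k))) :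
    ∃ G : Finset (PredictionFunction X B), G.card = d ∧ ∀ f : Estimator.{u, w} X B n,
      ∃ P : Measure (Data X B), IsProbabilityMeasure P ∧
        Nat.log 2 d * w * (1 - noisyLoss q ξ 1) * M * B ^ q ≤ f.excessRisk q P G := by
  rw [mul_comm 2 d, Nat.log_mul_base one_lt_two hd.ne'] at hX
  obtain ⟨x, hx⟩ := exists_embedding_of_card_le hX
  have : Nonempty (Set.Icc (-B) B) := ⟨⟨B, by linarith, le_rfl⟩⟩
  refine exists_finset_excessRisk_lower_bound (X := X) (n := n) hB
    (Nat.pow_log_le_self 2 hd.ne') hq hw hw1 h0 h1 hM0 hM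
    (fun o => x ((finSuccEquiv _).symm o)) (fun v => ?_)
  obtain ⟨g, hg, hgv⟩ := exists_measurable_interpolation
    (hx.comp (finSuccEquiv _).symm.injective) v
  exact ⟨g, hg, fun i => hgv (some i), Or.inr (hgv none)⟩

/-- Takes `w = 1 / m` and `ξ = √(m / (4 * n))`, the largest bias with `n * w * ξ ^ 2 ≤ 1 / 4`, so `M
= 1 / 2`. The condition on `d` is what gives `ξ ≤ 1`. -/
theorem exists_finset_small_exponent (hB : 0 < B) (hd : 0 < d) (hn : 0 < n) (hq : 1 ≤ q)
    (hqc : q ≤ criticalExponent d n) (hX : (Nat.log 2 d : ℕ∞) ≤ ENat.card X)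
    (hdn : d < 2 ^ (4 * n + 1)) :
    ∃ G : Finset (PredictionFunction X B), G.card = d ∧ ∀ f : Estimator.{u, w} X B n,
      ∃ P : Measure (Data X B), IsProbabilityMeasure P ∧
        smallExponentConst q * B ^ q * Real.sqrt ((Nat.log 2 d : ℝ) / (n : ℝ)) ≤
          f.excessRisk q P G := by
  rcases Nat.eq_zero_or_pos (Nat.log 2 d) with hm | hm
  · simpa [hm] using exists_finset_excessRisk_nonneg (X := X) (n := n) hB hd hq
  have hmn : Nat.log 2 d ≤ 4 * n := Nat.lt_succ_iff.1 (Nat.log_lt_of_lt_pow hd.ne' hdn)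
  have hn' : (0 : ℝ) < n := by positivity
  have hm' : (0 : ℝ) < Nat.log 2 d := by positivity
  have hmn' : (Nat.log 2 d : ℝ) ≤ 4 * n := by exact_mod_cast hmn
  set ξ := Real.sqrt ((Nat.log 2 d : ℝ) / (4 * (n : ℝ))) with hξ
  have hξ2 : ξ ^ 2 = (Nat.log 2 d : ℝ) / (4 * (n : ℝ)) := Real.sq_sqrt (by positivity)
  have h0 : 0 ≤ ξ := Real.sqrt_nonneg _
  have h1 : ξ ≤ 1 := by
    rw [hξ, Real.sqrt_le_iff, one_pow, div_le_one (by positivity)]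
    exact ⟨zero_le_one, hmn'⟩
  have hqξ : q ≤ 1 + ξ := by
    refine hqc.trans ?_
    rw [criticalExponent]
    linarith [min_le_left ξ 1]
  have hwξ : 1 / (Nat.log 2 d : ℝ) * ξ ^ 2 = 1 / (4 * n) := by
    rw [hξ2]; field_simp
  have hsqrt : Real.sqrt ((Nat.log 2 d : ℝ) / (n : ℝ)) = 2 * ξ := by
    rw [Real.sqrt_eq_iff_mul_self_eq_of_pos (by positivity)]
    calc 2 * ξ * (2 * ξ) = 4 * ξ ^ 2 := by ring
      _ = _ := by rw [hξ2]; field_simp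
  obtain ⟨G, hG, hf⟩ := exists_finset_of_uniform (X := X) (n := n) hB hd hq h0 h1 hm hX
    (by norm_num : (0 : ℝ) ≤ 1 / 2) (fun σ i => half_le_sum_min (by positivity)
      (by rw [Fintype.card_fin]; exact (mul_one_div_cancel hm'.ne').le) h0 h1 n
      (by rw [hwξ]; field_simp; norm_num)
      (by
        rw [hwξ, div_le_one (by positivity)]
        have : (1 : ℝ) ≤ n := by exact_mod_cast hn
        linarith) σ i)
  refine ⟨G, hG, fun f => ?_⟩
  obtain ⟨P, hP, hle⟩ := hf f
  refine ⟨P, hP, le_trans ?_ hle⟩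
  have hBq : 0 ≤ B ^ q := Real.rpow_nonneg hB.le q
  have hgap : smallExponentConst q * (2 * ξ) ≤ (1 - noisyLoss q ξ 1) * (1 / 2) := by
    rw [smallExponentConst]
    split_ifs with hq1
    · rw [noisyLoss_one hq, hq1, sub_self, Real.rpow_zero]
      linarith
    · linarith [mul_div_ten_le_one_sub_noisyLoss_one hq hqξ h1]
  rw [hsqrt]
  calc smallExponentConst q * B ^ q * (2 * ξ) = smallExponentConst q * (2 * ξ) * B ^ q := by ring
    _ ≤ _ := mul_le_mul_of_nonneg_right hgap hBq

/-- Labels are noiseless (`ξ = 1`) and uniform over more than `4 * n` points, so a given point is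
missed with probability at least `1 - n / m ≥ 3 / 4`. -/
theorem exists_finset_small_exponent_of_large_card (hB : 0 < B) (hd : 0 < d) (hn : 0 < n)
    (hq : 1 ≤ q) (hqc : q ≤ criticalExponent d n) (hX : (Nat.log 2 d : ℕ∞) ≤ ENat.card X)
    (hdn : 2 ^ (4 * n + 1) ≤ d) :
    ∃ G : Finset (PredictionFunction X B), G.card = d ∧ ∀ f : Estimator.{u, w} X B n,
      ∃ P : Measure (Data X B), IsProbabilityMeasure P ∧
        2 * smallExponentConst q * B ^ q ≤ f.excessRisk q P G := by
  have hmn : 4 * n + 1 ≤ Nat.log 2 d := Nat.le_log_of_pow_le one_lt_two hdn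
  have hm : 0 < Nat.log 2 d := by omega
  have hm' : (0 : ℝ) < Nat.log 2 d := by positivity
  have hmn' : 4 * (n : ℝ) + 1 ≤ Nat.log 2 d := by exact_mod_cast hmn
  have hw1 : 1 / (Nat.log 2 d : ℝ) ≤ 1 := by
    rw [div_le_one hm']
    exact_mod_cast hm
  have hM0 : (0 : ℝ) ≤ (1 - 1 / (Nat.log 2 d : ℝ)) ^ n := pow_nonneg (by linarith) n
  obtain ⟨G, hG, hf⟩ := exists_finset_of_uniform (X := X) (n := n) hB hd hq zero_le_one le_rfl
    hm hX hM0 (fun σ i => pow_le_sum_min (by positivity)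
      (by rw [Fintype.card_fin]; exact (mul_one_div_cancel hm'.ne').le) zero_le_one le_rfl n σ i)
  refine ⟨G, hG, fun f => ?_⟩
  obtain ⟨P, hP, hle⟩ := hf f
  refine ⟨P, hP, le_trans ?_ hle⟩
  refine mul_le_mul_of_nonneg_right ?_ (Real.rpow_nonneg hB.le q)
  rw [noisyLoss_one hq, sub_self, zero_mul, sub_zero, one_mul]
  have hbern := one_add_mul_le_pow (a := -(1 / (Nat.log 2 d : ℝ))) (by linarith) n
  rw [← sub_eq_add_neg] at hbern
  have hq2 : q ≤ 2 := by
    refine hqc.trans ?_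
    rw [criticalExponent]
    linarith [min_le_right (Real.sqrt ((Nat.log 2 d : ℝ) / (4 * (n : ℝ)))) 1]
  have hc : smallExponentConst q ≤ 1 / 4 := by
    rw [smallExponentConst]
    split_ifs <;> linarith
  have hnm : (n : ℝ) * (1 / (Nat.log 2 d : ℝ)) ≤ 1 / 4 := by
    rw [mul_one_div, div_le_iff₀ hm']
    linarith
  linarith

/-- The reciprocal of `1 - 1 / (n + 1)` is `1 + 1 / n ≤ exp (1 / n)`. -/
theorem exp_neg_one_le_one_sub_inv_pow (hn : 0 < n) :
    Real.exp (-1) ≤ (1 - 1 / ((n : ℝ) + 1)) ^ n := by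
  have hn' : (0 : ℝ) < n := by positivity
  have h : Real.exp (-(1 / (n : ℝ))) ≤ 1 - 1 / ((n : ℝ) + 1) := by
    rw [Real.exp_neg, inv_le_comm₀ (Real.exp_pos _) (by
      rw [sub_pos, div_lt_one (by positivity)]; linarith)]
    refine le_trans (le_of_eq ?_) (Real.add_one_le_exp (1 / (n : ℝ)))
    have e : 1 - 1 / ((n : ℝ) + 1) = n / (n + 1) := by field_simp; ring
    rw [e, inv_div, add_div, div_self hn'.ne', add_comm]
  calc Real.exp (-1) = Real.exp (-(1 / (n : ℝ))) ^ n := by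
        rw [← Real.exp_nat_mul]; congr 1; field_simp
    _ ≤ _ := pow_le_pow_left₀ (Real.exp_pos _).le h n

/-- Takes `ξ = 1` and `w = 1 / max m (n + 1)`: then `m * w ≤ 1`, and a given point is missed with
probability at least `exp (-1)`. -/
theorem exists_finset_noiseless (hB : 0 < B) (hd : 0 < d) (hn : 0 < n) (hq : 1 ≤ q)
    (hX : (Nat.log 2 (2 * d) : ℕ∞) ≤ ENat.card X) :
    ∃ G : Finset (PredictionFunction X B), G.card = d ∧ ∀ f : Estimator.{u, w} X B n,
      ∃ P : Measure (Data X B), IsProbabilityMeasure P ∧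
        Real.exp (-1) * B ^ q * min ((Nat.log 2 d : ℝ) / ((n : ℝ) + 1)) 1 ≤
          f.excessRisk q P G := by
  set D : ℝ := max (Nat.log 2 d : ℝ) ((n : ℝ) + 1) with hD
  have hnD : (n : ℝ) + 1 ≤ D := le_max_right _ _
  have hD0 : 0 < D := lt_of_lt_of_le (by positivity) hnD
  have hw1 : 1 / D ≤ 1 / ((n : ℝ) + 1) := one_div_le_one_div_of_le (by positivity) hnD
  have hn1 : 1 / ((n : ℝ) + 1) ≤ 1 := by
    rw [div_le_one (by positivity)]; linarith [(Nat.cast_nonneg n : (0 : ℝ) ≤ n)]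
  have hmD : (Nat.log 2 d : ℝ) * (1 / D) ≤ 1 := by
    rw [mul_one_div, div_le_one hD0]; exact le_max_left _ _
  have hmin : min ((Nat.log 2 d : ℝ) / ((n : ℝ) + 1)) 1 ≤ (Nat.log 2 d : ℝ) * (1 / D) := by
    rw [mul_one_div, hD]
    rcases le_total (Nat.log 2 d : ℝ) ((n : ℝ) + 1) with h | h
    · rw [max_eq_right h]; exact min_le_left _ _
    · rw [max_eq_left h, div_self (lt_of_lt_of_le (by positivity) h).ne']; exact min_le_right _ _
  obtain ⟨G, hG, hf⟩ := exists_finset_of_extra_point (X := X) (n := n) (w := 1 / D) hB hd hq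
    (by positivity) hmD zero_le_one le_rfl hX
    (pow_nonneg (by linarith) n : (0 : ℝ) ≤ (1 - 1 / D) ^ n)
    (fun σ i => pow_le_sum_min (by positivity) (by rwa [Fintype.card_fin]) zero_le_one le_rfl
      n σ i)
  refine ⟨G, hG, fun f => ?_⟩
  obtain ⟨P, hP, hle⟩ := hf f
  refine ⟨P, hP, le_trans ?_ hle⟩
  rw [noisyLoss_one hq, sub_self, zero_mul, sub_zero, mul_one]
  have hpow : Real.exp (-1) ≤ (1 - 1 / D) ^ n :=
    (exp_neg_one_le_one_sub_inv_pow hn).trans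
      (pow_le_pow_left₀ (by linarith) (by linarith) n)
  calc _ = min ((Nat.log 2 d : ℝ) / ((n : ℝ) + 1)) 1 * Real.exp (-1) * B ^ q := by ring
    _ ≤ _ := by gcongr

/-- Takes `ξ = q - 1` and the `w` with `n * w * ξ ^ 2 = 1 / 4`; `q` exceeding the threshold is what
gives `m * w ≤ 1`. The resulting constant is `q / (80 * (q - 1))` over `n`, relaxed to `90` over `n
+ 1`. -/
theorem exists_finset_noisy (hB : 0 < B) (hd : 0 < d) (hn : 0 < n) (hq : 1 < q) (hq2 : q ≤ 2)
    (hqc : criticalExponent d n < q) (hX : (Nat.log 2 (2 * d) : ℕ∞) ≤ ENat.card X) :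
    ∃ G : Finset (PredictionFunction X B), G.card = d ∧ ∀ f : Estimator.{u, w} X B n,
      ∃ P : Measure (Data X B), IsProbabilityMeasure P ∧
        q / (90 * (q - 1)) * B ^ q * min ((Nat.log 2 d : ℝ) / ((n : ℝ) + 1)) 1 ≤
          f.excessRisk q P G := by
  have hn' : (1 : ℝ) ≤ n := by exact_mod_cast hn
  obtain ⟨ε, rfl⟩ : ∃ ε, q = 1 + ε := ⟨q - 1, by ring⟩
  have hε : 0 < ε := by linarith
  have hε1 : ε ≤ 1 := by linarith
  have hlt : Real.sqrt ((Nat.log 2 d : ℝ) / (4 * (n : ℝ))) < ε := by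
    rw [criticalExponent] at hqc
    rcases min_lt_iff.1 (show min (Real.sqrt ((Nat.log 2 d : ℝ) / (4 * (n : ℝ)))) 1 < ε by
      linarith) with h | h
    · exact h
    · linarith
  have hm : (Nat.log 2 d : ℝ) ≤ 4 * n * ε ^ 2 := by
    have := (Real.sqrt_lt' hε).1 hlt
    rw [div_lt_iff₀ (by positivity)] at this
    linarith
  have hwε : 1 / (4 * n * ε ^ 2) * ε ^ 2 = 1 / (4 * n) := by field_simp
  have hmw : (Nat.log 2 d : ℝ) * (1 / (4 * n * ε ^ 2)) ≤ 1 := by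
    rw [mul_one_div, div_le_one (by positivity)]; exact hm
  obtain ⟨G, hG, hf⟩ := exists_finset_of_extra_point (X := X) (n := n)
    (w := 1 / (4 * n * ε ^ 2)) hB hd hq.le (by positivity) hmw hε.le hε1 hX
    (by norm_num : (0 : ℝ) ≤ 1 / 2) (fun σ i => half_le_sum_min (by positivity)
      (by rwa [Fintype.card_fin]) hε.le hε1 n (by rw [hwε]; field_simp; norm_num)
      (by rw [hwε, div_le_one (by positivity)]; linarith) σ i)
  refine ⟨G, hG, fun f => ?_⟩
  obtain ⟨P, hP, hle⟩ := hf f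
  refine ⟨P, hP, le_trans ?_ hle⟩
  have hgap := mul_div_ten_le_one_sub_noisyLoss_one hq.le le_rfl hε1
  have e : (1 + ε) / (90 * (1 + ε - 1)) = (1 + ε) / (90 * ε) := by ring_nf
  calc (1 + ε) / (90 * (1 + ε - 1)) * B ^ (1 + ε) * min ((Nat.log 2 d : ℝ) / ((n : ℝ) + 1)) 1
      ≤ (1 + ε) / (90 * ε) * B ^ (1 + ε) * ((Nat.log 2 d : ℝ) / ((n : ℝ) + 1)) := by
        rw [e]; gcongr; exact min_le_left _ _
    _ = (1 + ε) * Nat.log 2 d * B ^ (1 + ε) / ε * (1 / (90 * ((n : ℝ) + 1))) := by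
        field_simp
    _ ≤ (1 + ε) * Nat.log 2 d * B ^ (1 + ε) / ε * (1 / (80 * (n : ℝ))) := by
        gcongr; norm_num; linarith
    _ = Nat.log 2 d * (1 / (4 * n * ε ^ 2)) * ((1 + ε) * ε / 10) * (1 / 2) * B ^ (1 + ε) := by
        field_simp; ring
    _ ≤ _ := by gcongr

theorem exists_finset_large_exponent (hB : 0 < B) (hd : 0 < d) (hn : 0 < n)
    (hqc : criticalExponent d n < q) (hX : (Nat.log 2 (2 * d) : ℕ∞) ≤ ENat.card X) :
    ∃ G : Finset (PredictionFunction X B), G.card = d ∧ ∀ f : Estimator.{u, w} X B n,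
      ∃ P : Measure (Data X B), IsProbabilityMeasure P ∧
        max (q / (90 * (q - 1))) (Real.exp (-1)) * B ^ q *
          min ((Nat.log 2 d : ℝ) / ((n : ℝ) + 1)) 1 ≤ f.excessRisk q P G := by
  have hq : 1 < q := by
    refine lt_of_le_of_lt ?_ hqc
    rw [criticalExponent]
    linarith [le_min (Real.sqrt_nonneg ((Nat.log 2 d : ℝ) / (4 * (n : ℝ)))) zero_le_one]
  rcases le_total (q / (90 * (q - 1))) (Real.exp (-1)) with h | h
  · rw [max_eq_right h]
    exact exists_finset_noiseless hB hd hn hq.le hX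
  · rw [max_eq_left h]
    refine exists_finset_noisy hB hd hn hq ?_ hqc hX
    -- The noisy term dominates only for `q` close to 1: it forces `30 * (q - 1) ≤ q`, hence `q ≤
    -- 2`.
    have he : (1 : ℝ) / 3 ≤ Real.exp (-1) := by
      rw [Real.exp_neg, ← one_div]
      exact one_div_le_one_div_of_le (Real.exp_pos 1) (by linarith [Real.exp_one_lt_d9])
    have := he.trans h
    rw [le_div_iff₀ (by linarith)] at this
    linarith

end Cases

end LqRegression

end

theorem mainTheorem10 {X : Type u} [MeasurableSpace X]
    [MeasurableSpace.SeparatesPoints X] [Nonempty X]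
    (B q : ℝ) (hB : 0 < B) (d n : ℕ) (hd : 0 < d) (hn : 0 < n) :
    (1 ≤ q → q ≤ LqRegression.criticalExponent d n →
      (Nat.log 2 d : ℕ∞) ≤ ENat.card X →
      ∃ G : Finset (LqRegression.PredictionFunction X B), G.card = d ∧
        ∀ f : LqRegression.Estimator.{u, w} X B n,
          ∃ P : MeasureTheory.Measure (LqRegression.Data X B),
            MeasureTheory.IsProbabilityMeasure P ∧
            (if d < 2 ^ (4 * n + 1) then
                LqRegression.smallExponentConst q * B ^ q *
                  Real.sqrt ((Nat.log 2 d : ℝ) / (n : ℝ))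
              else 2 * LqRegression.smallExponentConst q * B ^ q)
              ≤ f.excessRisk q P G) ∧
    (LqRegression.criticalExponent d n < q →
      (Nat.log 2 (2 * d) : ℕ∞) ≤ ENat.card X →
      ∃ G : Finset (LqRegression.PredictionFunction X B), G.card = d ∧
        ∀ f : LqRegression.Estimator.{u, w} X B n,
          ∃ P : MeasureTheory.Measure (LqRegression.Data X B),
            MeasureTheory.IsProbabilityMeasure P ∧
            max (q / (90 * (q - 1))) (Real.exp (-1)) * B ^ q *
                min ((Nat.log 2 d : ℝ) / ((n : ℝ) + 1)) 1
              ≤ f.excessRisk q P G) := by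
  refine ⟨fun hq hqc hX => ?_, fun hqc hX =>
    LqRegression.exists_finset_large_exponent hB hd hn hqc hX⟩
  split_ifs with h
  · exact LqRegression.exists_finset_small_exponent hB hd hn hq hqc hX h
  · exact LqRegression.exists_finset_small_exponent_of_large_card hB hd hn hq hqc hX
      (not_lt.1 h)
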